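/- Let $G=(V,E)$ be the $n\times n$ grid graph, with $N=n^2$ vertices. For a ground truth $y\in\{-1,+1\}^V$, independent observations $X$ are drawn as follows: for each edge $uv\in E$, $X_{uv}=y_uy_v$ with probability $1-p$ and $X_{uv}=-y_uy_v$ with probability $p$; for each vertex $v\in V$, $X_v=y_v$ with probability $1-q$ and $X_v=-y_v$ with probability $q$. The error of an algorithm $\mathcal A:\{-1,+1\}^E\times\{-1,+1\}^V\to\{-1,+1\}^V$ is $$e(\mathcal A)=\max_{y\in\{-1,+1\}^V}\ \mathbb E_{X\mid y}\bigl[\,|\{v\in V:\mathcal A(X)_v\ne y_v\}|\,\bigr].$$ The two-stage algorithm $\bar{\mathcal A}$ first computes, from the edge observations alone, a labeling $\widehat Y\in\{-1,+1\}^V$ that maximizes $\sum_{uv\in E}X_{uv}Y_uY_v$ over all $Y\in\{-1,+1\}^V$ (ties broken by an arbitrary function of the edge observations); it then outputs $-\widehat Y$ if $\sum_{v\in V}X_v\widehat Y_v<0$, and $\widehat Y$ otherwise. Theorem. There is an absolute constant $C$ such that for all $0<p<1/39$ and $0\le q<1/2$ there is $N_0=N_0(p,q)$ such that for every $n$ with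 $N=n^2\ge N_0$ (and every tie-breaking rule), $$e(\bar{\mathcal A})\le C\,p^2N.$$ -/

import Mathlib

open MeasureTheory

namespace GridRecovery

/-- The `n × n` grid graph: the Cartesian product of two paths on `n` vertices. -/
abbrev gridGraph (n : ℕ) : SimpleGraph (Fin n × Fin n) :=
  (SimpleGraph.pathGraph n).boxProd (SimpleGraph.pathGraph n)

noncomputable instance gridGraphEdgeFintype (n : ℕ) : Fintype (gridGraph n).edgeSet :=
  Fintype.ofFinite _

section Model

variable {V : Type*} (G : SimpleGraph V)

/-- Labelings of the vertices by `-1` or `+1`; the units of `ℤ` are exactly `-1` and `+1`. -/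
abbrev Labeling (V : Type*) : Type _ := V → ℤˣ

/-- One `±1` observation per edge. -/
abbrev EdgeObs : Type _ := G.edgeSet → ℤˣ

/-- A full input: one `±1` observation per edge and one per vertex. -/
abbrev Obs : Type _ := EdgeObs G × (V → ℤˣ)

variable {G}

/-- The product `y u * y v` of the labels of the two endpoints of an edge `uv`. -/
def edgeSign (y : Labeling V) (e : G.edgeSet) : ℤˣ := (Sym2.map y (e : Sym2 V)).mul

/-- The law of a noisy copy of the sign `s`: it is `s` with probability `1 - ε` and `-s` with
probability `ε` (for `0 ≤ ε ≤ 1`). -/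
noncomputable def noisySign (ε : ℝ) (s : ℤˣ) : Measure ℤˣ :=
  ENNReal.ofReal (1 - ε) • Measure.dirac s + ENNReal.ofReal ε • Measure.dirac (-s)

variable (G) in
/-- The law of the input when the ground truth is `y`: all edge and vertex observations are
independent, the observation on `uv` being a noisy copy of `y u * y v` with noise `p`, and the
observation at `v` being a noisy copy of `y v` with noise `q`. -/
noncomputable def obsLaw [Fintype V] [Fintype G.edgeSet] (p q : ℝ) (y : Labeling V) :
    Measure (Obs G) :=
  (Measure.pi fun e : G.edgeSet => noisySign p (edgeSign y e)).prod
    (Measure.pi fun v : V => noisySign q (y v))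

/-- `e_y(A)`: the expected number of mislabeled vertices when the ground truth is `y`. -/
noncomputable def errorAt [Fintype V] [Fintype G.edgeSet] (p q : ℝ) (A : Obs G → Labeling V)
    (y : Labeling V) : ℝ :=
  ∫ x, (hammingDist (A x) y : ℝ) ∂(obsLaw G p q y)

/-- `e(A)`: the worst case over the (finitely many) ground truths of the expected error. -/
noncomputable def worstError [Fintype V] [Fintype G.edgeSet] (p q : ℝ)
    (A : Obs G → Labeling V) : ℝ :=
  ⨆ y : Labeling V, errorAt p q A y

/-- The objective `∑_{uv ∈ E} X_{uv} y_u y_v` of the first stage. -/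
def agreement [Fintype G.edgeSet] (x : EdgeObs G) (y : Labeling V) : ℤ :=
  ∑ e : G.edgeSet, ((x e * edgeSign y e : ℤˣ) : ℤ)

/-- `M` implements the first stage: from the edge observations alone it computes a labeling of
maximum agreement (ties are broken in an arbitrary way). -/
def IsAgreementMaximizer [Fintype G.edgeSet] (M : EdgeObs G → Labeling V) : Prop :=
  ∀ (x : EdgeObs G) (y : Labeling V), agreement x y ≤ agreement x (M x)

/-- The two-stage algorithm with first stage `M`: the labeling `M` of the edge observations is
negated exactly when the vote `∑_v X_v Ŷ_v` of the vertex observations is negative. -/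
def twoStage [Fintype V] (M : EdgeObs G → Labeling V) (x : Obs G) : Labeling V :=
  if ∑ v : V, ((x.2 v * M x.1 v : ℤˣ) : ℤ) < 0 then -M x.1 else M x.1

end Model

end GridRecovery

/-! Up to a global sign, the error of the first stage `Ŷ` against the truth `y` is the smaller class
(`minority`) of `s = Ŷ * y`. In the planar dual, with the outer face cut open along the boundary,
the cut of `s` has even degree at every unit square. It can therefore be peeled into edge-disjoint
cycles and paths between outer faces, each of which is itself the cut of some labeling `t`
(`exists_elementary_cut_subset`, `exists_cut_of_isTrail`). Multiplying `Ŷ` by `t` cannot raise the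
agreement, so at least half of the `k` edges of such a piece are corrupted; this has probability at
most `2 ^ k * p ^ ⌈k/2⌉`. By isoperimetry and subadditivity of `minority`, a piece of `k` edges
costs at most `k ^ 2` vertices (`minority_le_sum_elementaryCuts`).

There are `O(n² 3^k)` cycles and `O(n 3^k)` paths of size `k`, so the expected loss is governed by
`∑ k² 6^k p^⌈k/2⌉`, which converges because `36 p < 1`. Cycles have `k ≥ 3` and contribute `O(n²
p²)`; paths have `k ≥ 1` and contribute `O(n p)`, which is at most `O(n² p²)` once `n p ≥ 1`.

The vote picks the wrong sign only if it is far from its mean or `minority s` exceeds a constant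
fraction of `N`. Chebyshev bounds the cost of the first event by `4 / (1 - 2q)²`, a constant
absorbed for large `N`; the second is charged to `minority s`. -/

namespace GridRecovery

/-! ### Cycles and paths in graphs, and counting them by non-backtracking walks -/

section WalkCounting

/-- A graph with finitely many edges in which every non-isolated vertex outside `B` has at least
two neighbours contains a cycle or a path joining two vertices of `B`. -/
lemma exists_isCycle_or_isPath_of_two_neighbors {W : Type*} (H : SimpleGraph W)
    [Finite H.edgeSet] (B : W → Prop)
    (hB : ∀ x y, ¬ B x → H.Adj x y → ∃ z, z ≠ y ∧ H.Adj x z) (hH : H.edgeSet.Nonempty) :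
    (∃ (u : W) (c : H.Walk u u), c.IsCycle) ∨
      ∃ (u v : W) (p : H.Walk u v), p.IsPath ∧ u ≠ v ∧ B u ∧ B v := by
  by_cases hac : H.IsAcyclic
  swap
  · left
    unfold SimpleGraph.IsAcyclic at hac
    push Not at hac
    exact hac
  right
  obtain ⟨e, he⟩ := hH
  induction e using Sym2.ind with | _ a b =>
  rw [SimpleGraph.mem_edgeSet] at he
  have : Nonempty W := ⟨a⟩
  -- Take a longest path. A second neighbour of an endpoint would either lie on the path, against
  -- acyclicity, or extend it; so both endpoints lie in `B`.
  obtain ⟨u, v, p, hp, hmax⟩ :=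
    SimpleGraph.Walk.exists_isPath_forall_isPath_length_le_length H
  have hlen : 1 ≤ p.length := by
    refine le_trans ?_ (hmax a b (SimpleGraph.Walk.cons he SimpleGraph.Walk.nil) ?_)
    · simp
    · simp [he.ne]
  have hnil : ¬ p.Nil := by
    rw [SimpleGraph.Walk.not_nil_iff_lt_length]; exact hlen
  have huv : u ≠ v := hp.nil_iff_eq.not.mp hnil
  refine ⟨u, v, p, hp, huv, ?_, ?_⟩
  · by_contra hBu
    obtain ⟨z, hz, hadj⟩ := hB u _ hBu (p.adj_snd hnil)
    refine hz (hac.eq_snd_of_adj_start hp hadj ?_)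
    by_contra hmem
    have := hmax _ _ _ (hp.cons (h := hadj.symm) hmem)
    simp at this
  · by_contra hBv
    obtain ⟨z, hz, hadj⟩ := hB v _ hBv (p.adj_penultimate hnil).symm
    refine hz (hac.eq_penultimate_of_adj_end hp hadj ?_)
    by_contra hmem
    have := hmax _ _ _ (hp.concat hmem (h := hadj))
    simp at this

variable {W : Type*} [DecidableEq W]

/-- The possible new first vertices of a non-backtracking walk with the given vertex list. -/
def extensions (nbr : W → Finset W) : List W → Finset W
  | [] => ∅
  | [v] => nbr v
  | v :: w :: _ => (nbr v).erase w

/-- Vertex lists of the non-backtracking walks with `k` steps that end in `St`. -/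
def nonBacktracking (nbr : W → Finset W) (St : Finset W) : ℕ → Finset (List W)
  | 0 => St.image fun v => [v]
  | k + 1 => (nonBacktracking nbr St k).biUnion fun l => (extensions nbr l).image (· :: l)

lemma exists_of_mem_nonBacktracking_succ {nbr : W → Finset W} {St : Finset W} {k : ℕ} {l : List W}
    (hl : l ∈ nonBacktracking nbr St (k + 1)) : ∃ v w t, l = v :: w :: t ∧ v ∈ nbr w := by
  simp only [nonBacktracking, Finset.mem_biUnion, Finset.mem_image] at hl
  obtain ⟨m, -, v, hv, rfl⟩ := hl
  match m, hv with
  | [w], hv => exact ⟨v, w, [], rfl, hv⟩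
  | w :: x :: t, hv => exact ⟨v, w, x :: t, rfl, Finset.mem_of_mem_erase hv⟩

/-- The first step has `d + 1` choices. Each later step has at most `d`, since by symmetry the
vertex just left is one of the neighbours and is erased. -/
lemma card_nonBacktracking_succ_le {nbr : W → Finset W} (St : Finset W) {d : ℕ}
    (hsymm : ∀ v w, v ∈ nbr w → w ∈ nbr v) (hcard : ∀ v, (nbr v).card ≤ d + 1) (k : ℕ) :
    (nonBacktracking nbr St (k + 1)).card ≤ St.card * (d + 1) * d ^ k := by
  induction k with
  | zero =>
    have h0 : (nonBacktracking nbr St 0).card ≤ St.card := Finset.card_image_le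
    refine (Finset.card_biUnion_le_card_mul _ _ (d + 1) ?_).trans ?_
    · intro l hl
      simp only [nonBacktracking, Finset.mem_image] at hl
      obtain ⟨v, -, rfl⟩ := hl
      exact Finset.card_image_le.trans (hcard v)
    · rw [pow_zero, mul_one]; gcongr
  | succ k ih =>
    refine (Finset.card_biUnion_le_card_mul _ _ d ?_).trans ?_
    · intro l hl
      obtain ⟨v, w, t, rfl, h⟩ := exists_of_mem_nonBacktracking_succ hl
      refine Finset.card_image_le.trans ?_
      have := Finset.card_erase_of_mem (hsymm _ _ h)
      have h2 := hcard v
      simp only [extensions]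
      omega
    · calc _ ≤ (St.card * (d + 1) * d ^ k) * d := by gcongr
        _ = _ := by ring

/-- A path repeats no vertex, so prepending its first vertex to the tail never steps back. -/
lemma support_mem_nonBacktracking {nbr : W → Finset W} {St : Finset W} {H : SimpleGraph W}
    (hH : ∀ u v, H.Adj u v → u ∈ nbr v) {u v : W} (p : H.Walk u v) (hp : p.IsPath)
    (hv : v ∈ St) : p.support ∈ nonBacktracking nbr St p.length := by
  induction p with
  | nil => simpa [nonBacktracking] using hv
  | @cons a b c h q ih =>
    have hq := hp.of_cons
    have := ih hq hv
    rw [SimpleGraph.Walk.support_cons, SimpleGraph.Walk.length_cons]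
    simp only [nonBacktracking, Finset.mem_biUnion, Finset.mem_image]
    refine ⟨q.support, this, a, ?_, rfl⟩
    have hnot : a ∉ q.support := ((SimpleGraph.Walk.cons_isPath_iff _ _).1 hp).2
    cases q with
    | nil => simpa [extensions] using hH _ _ h
    | @cons _ x _ h' r =>
      have : extensions nbr (SimpleGraph.Walk.cons h' r).support = (nbr b).erase x := by
        cases r <;> rfl
      rw [this, Finset.mem_erase]
      refine ⟨?_, hH _ _ h⟩
      rintro rfl
      apply hnot
      simp

/-- The edges traversed by a walk with the given vertex list. -/
def listEdges (l : List W) : List (Sym2 W) := List.zipWith (s(·, ·)) l l.tail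

/-- A bound on the number of edge sets of paths with `k + 1` steps ending in `St`. -/
lemma card_pathEdgeSets_le {nbr : W → Finset W} (St : Finset W) {H : SimpleGraph W}
    (hH : ∀ u v, H.Adj u v → u ∈ nbr v) {d : ℕ}
    (hsymm : ∀ v w, v ∈ nbr w → w ∈ nbr v) (hcard : ∀ v, (nbr v).card ≤ d + 1) (k : ℕ)
    (A : Finset (Finset (Sym2 W)))
    (hA : ∀ F ∈ A, ∃ (u v : W) (p : H.Walk u v), p.IsPath ∧ v ∈ St ∧ p.length = k + 1 ∧
      F = p.edges.toFinset) :
    A.card ≤ St.card * (d + 1) * d ^ k := by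
  refine le_trans ?_ (card_nonBacktracking_succ_le St hsymm hcard k)
  refine (Finset.card_le_card (t := (nonBacktracking nbr St (k + 1)).image
    fun l => (listEdges l).toFinset) ?_).trans Finset.card_image_le
  intro F hF
  obtain ⟨u, v, p, hp, hv, hl, rfl⟩ := hA F hF
  rw [Finset.mem_image]
  refine ⟨p.support, hl ▸ support_mem_nonBacktracking hH p hp hv, ?_⟩
  rw [listEdges, SimpleGraph.Walk.edges_eq_zipWith_support]

/-- A bound on the number of edge sets of cycles with `k + 2` steps through vertices of `St`. -/
lemma card_cycleEdgeSets_le {nbr : W → Finset W} (St : Finset W) {H : SimpleGraph W}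
    (hH : ∀ u v, H.Adj u v → u ∈ nbr v) {d : ℕ}
    (hsymm : ∀ v w, v ∈ nbr w → w ∈ nbr v) (hcard : ∀ v, (nbr v).card ≤ d + 1) (k : ℕ)
    (A : Finset (Finset (Sym2 W)))
    (hA : ∀ F ∈ A, ∃ (u : W) (c : H.Walk u u), c.IsCycle ∧ u ∈ St ∧ c.length = k + 2 ∧
      F = c.edges.toFinset) :
    A.card ≤ St.card * (d + 1) * d ^ k := by
  refine le_trans ?_ (card_nonBacktracking_succ_le St hsymm hcard k)
  -- Without its first edge, a cycle of length `k + 2` is a path of `k + 1` steps ending at the base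
  -- point. Prepending the last vertex of the list restores the missing edge.
  refine (Finset.card_le_card (t := (nonBacktracking nbr St (k + 1)).image
    fun l => ((l.getLast?.toList ++ l : List W) |> listEdges).toFinset) ?_).trans
    Finset.card_image_le
  intro F hF
  obtain ⟨u, c, hc, hu, hl, rfl⟩ := hA F hF
  cases c with
  | nil => simp at hl
  | @cons _ v _ h p =>
    have hp : p.IsPath := ((SimpleGraph.Walk.cons_isCycle_iff _ _).1 hc).1
    rw [SimpleGraph.Walk.length_cons] at hl
    have hl' : p.length = k + 1 := by omega
    rw [Finset.mem_image]
    refine ⟨p.support, hl' ▸ support_mem_nonBacktracking hH p hp hu, ?_⟩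
    have : p.support.getLast?.toList ++ p.support = (SimpleGraph.Walk.cons h p).support := by
      rw [SimpleGraph.Walk.support_cons, List.getLast?_eq_some_getLast p.support_ne_nil,
        SimpleGraph.Walk.getLast_support]
      rfl
    simp only [this]
    rw [listEdges, SimpleGraph.Walk.edges_eq_zipWith_support]

end WalkCounting

/-! ### Cuts of labelings and agreement maximality -/

section Cuts

variable {V : Type*} {G : SimpleGraph V}

lemma edgeSign_mul (s t : Labeling V) (e : G.edgeSet) :
    edgeSign (s * t) e = edgeSign s e * edgeSign t e := by
  obtain ⟨e, he⟩ := e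
  induction e using Sym2.ind with | _ a b =>
  simp only [edgeSign, Sym2.map_mk, Sym2.mul_mk, Pi.mul_apply]
  exact mul_mul_mul_comm _ _ _ _

variable [Fintype G.edgeSet]

variable (G) in
/-- The edges whose endpoints have different labels. -/
def cut (s : Labeling V) : Finset G.edgeSet := {e | edgeSign s e = -1}

lemma mem_cut {s : Labeling V} {e : G.edgeSet} : e ∈ cut G s ↔ edgeSign s e = -1 := by
  simp [cut]

/-- Edge signs are multiplicative, so the cut of a product is a symmetric difference of cuts. -/
lemma cut_mul_eq_sdiff [DecidableEq G.edgeSet] {s t : Labeling V} (h : cut G t ⊆ cut G s) :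
    cut G (s * t) = cut G s \ cut G t := by
  ext e
  have := @h e
  simp only [mem_cut, Finset.mem_sdiff, edgeSign_mul] at this ⊢
  rcases Int.units_eq_one_or (edgeSign s e) with hs | hs <;>
    rcases Int.units_eq_one_or (edgeSign t e) with ht | ht <;> simp_all

/-- An agreement maximizer `z` is wrong on a cut only if at least half of the cut is corrupted. -/
lemma card_cut_le_of_agreement_maximal {x : EdgeObs G} {z y t : Labeling V}
    (hz : agreement x (z * t) ≤ agreement x z) (ht : cut G t ⊆ cut G (z * y)) :
    (cut G t).card ≤ 2 * ((cut G t).filter fun e => x e = -edgeSign y e).card := by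
  classical
  -- Only edges in the cut of `t` change sign. There `z` and `y` have opposite edge signs, so a
  -- corrupted edge agrees with `z` and loses `2` under the flip, while a correct one gains `2`.
  have h1 : ∀ e, ((x e * edgeSign z e : ℤˣ) : ℤ) - ((x e * edgeSign (z * t) e : ℤˣ) : ℤ) =
      if e ∈ cut G t then (if x e = -edgeSign y e then 2 else 0) - (if x e = -edgeSign y e then
        0 else 2) else 0 := by
    intro e
    have := @ht e
    simp only [mem_cut, edgeSign_mul] at this ⊢
    rcases Int.units_eq_one_or (edgeSign t e) with h | h
    · simp [h]
    · have h2 := this h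
      rcases Int.units_eq_one_or (edgeSign z e) with h3 | h3 <;>
      rcases Int.units_eq_one_or (edgeSign y e) with h4 | h4 <;>
      rcases Int.units_eq_one_or (x e) with h5 | h5 <;> simp_all
  have h2 : 0 ≤ ∑ e : G.edgeSet, (((x e * edgeSign z e : ℤˣ) : ℤ) -
      ((x e * edgeSign (z * t) e : ℤˣ) : ℤ)) := by
    rw [Finset.sum_sub_distrib]
    exact sub_nonneg.2 hz
  rw [Finset.sum_congr rfl fun e _ => h1 e, ← Finset.sum_filter, Finset.filter_mem_eq_inter,
    Finset.univ_inter, Finset.sum_sub_distrib, ← Finset.sum_filter] at h2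
  have h3 : ∑ e ∈ cut G t, (if x e = -edgeSign y e then (0 : ℤ) else 2) =
      ∑ e ∈ (cut G t).filter (fun e => ¬ x e = -edgeSign y e), 2 := by
    rw [Finset.sum_filter]
    refine Finset.sum_congr rfl fun e _ => ?_
    split_ifs <;> rfl
  rw [h3] at h2
  simp only [Finset.sum_const, nsmul_eq_mul] at h2
  have h4 := Finset.card_filter_add_card_filter_not (s := cut G t)
    (fun e => x e = -edgeSign y e)
  omega

end Cuts

/-! ### Size of the smaller label class -/

section Minority

variable {V : Type*} [Fintype V]

/-- The number of vertices labeled `-1`. -/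
def negCount (s : Labeling V) : ℕ := (Finset.univ.filter fun v => s v = -1).card

/-- The size of the smaller of the two label classes. -/
def minority (s : Labeling V) : ℕ := min (negCount s) (negCount (-s))

lemma negCount_mul_le (s t : Labeling V) : negCount (s * t) ≤ negCount s + negCount t := by
  classical
  refine (Finset.card_le_card ?_).trans (Finset.card_union_le _ _)
  intro v
  simp only [Finset.mem_filter, Finset.mem_univ, true_and, Finset.mem_union, Pi.mul_apply]
  intro h
  by_contra! hc
  have h1 := (Int.units_eq_one_or (s v)).resolve_right hc.1
  have h2 := (Int.units_eq_one_or (t v)).resolve_right hc.2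
  rw [h1, h2] at h
  exact absurd h (by decide)

lemma negCount_add_negCount_neg (s : Labeling V) :
    negCount s + negCount (-s) = Fintype.card V := by
  have := Finset.card_filter_add_card_filter_not (s := (Finset.univ : Finset V))
    (fun v => s v = -1)
  rw [negCount, negCount, ← Finset.card_univ, ← this]
  congr 2
  refine Finset.filter_congr fun v _ => ?_
  rcases Int.units_eq_one_or (s v) with h | h <;> simp [h]

/-- Subadditivity of `negCount` is applied to all four sign choices of `±s` and `±t`. -/
lemma minority_mul_le (s t : Labeling V) : minority (s * t) ≤ minority s + minority t := by
  have h1 := negCount_mul_le s t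
  have h2 := negCount_mul_le (-s) t
  have h3 := negCount_mul_le s (-t)
  have h4 := negCount_mul_le (-s) (-t)
  rw [neg_mul] at h2
  rw [mul_neg] at h3
  rw [neg_mul_neg] at h4
  simp only [minority]
  omega

end Minority

/-! ### Grid edges, their dual edges, and isoperimetry -/

section Grid

variable {n : ℕ}

/-- The edge joining `(i, j)` and `(i + 1, j)`. -/
def rowEdge (i j : ℕ) (hi : i + 1 < n) (hj : j < n) : (gridGraph n).edgeSet :=
  ⟨s((⟨i, by omega⟩, ⟨j, hj⟩), (⟨i + 1, hi⟩, ⟨j, hj⟩)), by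
    simp [SimpleGraph.boxProd_adj, SimpleGraph.pathGraph_adj]⟩

/-- The edge joining `(i, j)` and `(i, j + 1)`. -/
def colEdge (i j : ℕ) (hi : i < n) (hj : j + 1 < n) : (gridGraph n).edgeSet :=
  ⟨s((⟨i, hi⟩, ⟨j, by omega⟩), (⟨i, hi⟩, ⟨j + 1, hj⟩)), by
    simp [SimpleGraph.boxProd_adj, SimpleGraph.pathGraph_adj]⟩

lemma eq_rowEdge_or_eq_colEdge (e : (gridGraph n).edgeSet) :
    (∃ i j hi hj, e = rowEdge i j hi hj) ∨ ∃ i j hi hj, e = colEdge i j hi hj := by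
  obtain ⟨e, he⟩ := e
  induction e using Sym2.ind with | _ a b =>
  obtain ⟨⟨a1, ha1⟩, ⟨a2, ha2⟩⟩ := a
  obtain ⟨⟨b1, hb1⟩, ⟨b2, hb2⟩⟩ := b
  have he' := he
  simp only [SimpleGraph.mem_edgeSet, SimpleGraph.boxProd_adj, SimpleGraph.pathGraph_adj,
    Fin.mk.injEq] at he'
  rcases he' with ⟨h | h, h'⟩ | ⟨h | h, h'⟩ <;> subst h <;> subst h'
  · exact Or.inl ⟨a1, a2, hb1, ha2, rfl⟩
  · exact Or.inl ⟨b1, a2, ha1, ha2, Subtype.ext Sym2.eq_swap⟩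
  · exact Or.inr ⟨a1, a2, ha1, hb2, rfl⟩
  · exact Or.inr ⟨a1, b2, ha1, ha2, Subtype.ext Sym2.eq_swap⟩

/-- The pair of faces separated by a grid edge; the face `(a, b)` is the unit square with corners
`(a - 1, b - 1)` and `(a, b)`. -/
def dualEdge (e : (gridGraph n).edgeSet) : Sym2 (ℕ × ℕ) :=
  Sym2.lift ⟨fun u v : Fin n × Fin n =>
    s((max u.1.1 v.1.1, max u.2.1 v.2.1), (min u.1.1 v.1.1 + 1, min u.2.1 v.2.1 + 1)), by
      intro u v; simp only [max_comm, min_comm]⟩ e.1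

lemma dualEdge_rowEdge (i j : ℕ) (hi : i + 1 < n) (hj : j < n) :
    dualEdge (rowEdge i j hi hj) = s((i + 1, j), (i + 1, j + 1)) := by
  simp [dualEdge, rowEdge]

lemma dualEdge_colEdge (i j : ℕ) (hi : i < n) (hj : j + 1 < n) :
    dualEdge (colEdge i j hi hj) = s((i, j + 1), (i + 1, j + 1)) := by
  simp [dualEdge, colEdge]

lemma dualEdge_injective : Function.Injective (dualEdge (n := n)) := by
  intro e f h
  rcases eq_rowEdge_or_eq_colEdge e with ⟨i, j, hi, hj, rfl⟩ | ⟨i, j, hi, hj, rfl⟩ <;>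
  rcases eq_rowEdge_or_eq_colEdge f with ⟨k, l, hk, hl, rfl⟩ | ⟨k, l, hk, hl, rfl⟩ <;>
  simp only [dualEdge_rowEdge, dualEdge_colEdge, Sym2.eq_iff, Prod.mk.injEq] at h
  · obtain ⟨rfl, rfl⟩ : i = k ∧ j = l := by omega
    rfl
  · omega
  · omega
  · obtain ⟨rfl, rfl⟩ : i = k ∧ j = l := by omega
    rfl

lemma edgeSign_rowEdge (s : Labeling (Fin n × Fin n)) (i j : ℕ) (hi : i + 1 < n) (hj : j < n) :
    edgeSign s (rowEdge i j hi hj) =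
      s (⟨i, by omega⟩, ⟨j, hj⟩) * s (⟨i + 1, hi⟩, ⟨j, hj⟩) := rfl

lemma edgeSign_colEdge (s : Labeling (Fin n × Fin n)) (i j : ℕ) (hi : i < n) (hj : j + 1 < n) :
    edgeSign s (colEdge i j hi hj) =
      s (⟨i, hi⟩, ⟨j, by omega⟩) * s (⟨i, hi⟩, ⟨j + 1, hj⟩) := rfl

/-- A sign function on the dual edges whose product around each unit square is `1` is a
coboundary. -/
lemma exists_labeling_of_square_prod_eq_one (g : Sym2 (ℕ × ℕ) → ℤˣ)
    (hg : ∀ i j, i + 1 < n → j + 1 < n →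
      g s((i + 1, j), (i + 1, j + 1)) * g s((i + 1, j + 1), (i + 1, j + 2)) *
        g s((i, j + 1), (i + 1, j + 1)) * g s((i + 1, j + 1), (i + 2, j + 1)) = 1) :
    ∃ t : Labeling (Fin n × Fin n), ∀ e, edgeSign t e = g (dualEdge e) := by
  -- `T i j` integrates `g` from the corner along `(·, 0)` up to `(i, 0)`, then along `(i, ·)`.
  -- Edges in the second direction are then correct by construction; those in the first follow by
  -- induction on `j`, one unit square at a time.
  set T : ℕ → ℕ → ℤˣ := fun i j => (∏ k ∈ Finset.range i, g s((k + 1, 0), (k + 1, 1))) *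
    ∏ l ∈ Finset.range j, g s((i, l + 1), (i + 1, l + 1)) with hT
  have hcol : ∀ i j, T i (j + 1) = T i j * g s((i, j + 1), (i + 1, j + 1)) := by
    intro i j
    simp only [hT]
    rw [Finset.prod_range_succ, mul_assoc]
  have hrow : ∀ j i, i + 1 < n → j < n →
      T i j * T (i + 1) j = g s((i + 1, j), (i + 1, j + 1)) := by
    intro j
    induction j with
    | zero =>
      intro i _ _
      simp only [hT, Finset.prod_range_succ, Finset.prod_range_zero, mul_one, zero_add]
      rw [← mul_assoc, Int.units_mul_self, one_mul]
    | succ j ih =>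
      intro i hi hj
      have h1 := ih i hi (by omega)
      have h2 := hg i j hi hj
      rw [hcol, hcol]
      generalize T i j = a at *
      generalize T (i + 1) j = b at *
      generalize g s((i + 1, j), (i + 1, j + 1)) = c at *
      simp only [add_assoc, one_add_one_eq_two] at *
      generalize g s((i + 1, j + 1), (i + 1, j + 2)) = d at *
      generalize g s((i, j + 1), (i + 1, j + 1)) = e at *
      generalize g s((i + 1, j + 1), (i + 2, j + 1)) = f at *
      subst h1
      revert h2
      revert a b d e f
      decide
  refine ⟨fun v => T v.1 v.2, fun e => ?_⟩
  rcases eq_rowEdge_or_eq_colEdge e with ⟨i, j, hi, hj, rfl⟩ | ⟨i, j, hi, hj, rfl⟩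
  · rw [edgeSign_rowEdge, dualEdge_rowEdge]
    exact hrow j i hi hj
  · rw [edgeSign_colEdge, dualEdge_colEdge]
    simp only [hcol]
    rw [← mul_assoc, Int.units_mul_self, one_mul]

/-- Isoperimetry: the smaller side of a cut is at most quadratic in the size of the cut. -/
lemma minority_le_card_cut_sq (s : Labeling (Fin n × Fin n)) :
    minority s ≤ (cut (gridGraph n) s).card ^ 2 := by
  classical
  set K := cut (gridGraph n) s
  have hN : minority s ≤ n ^ 2 := by
    have := negCount_add_negCount_neg s
    simp only [Fintype.card_prod, Fintype.card_fin] at this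
    simp only [minority]
    nlinarith [min_le_left (negCount s) (negCount (-s))]
  by_cases hK : n ≤ K.card
  · exact hN.trans (Nat.pow_le_pow_left hK 2)
  push Not at hK
  -- `R` and `Q` collect the lines of each direction that contain a cut edge; `s` is constant on
  -- every other line. As the cut has fewer than `n` edges, cut-free lines `i0` and `j0` exist, and
  -- a vertex outside `R ×ˢ Q` is joined to `(i0, j0)` along cut-free lines.
  set R : Finset (Fin n) := Finset.univ.filter fun i => ∃ e ∈ K, ∀ v ∈ e.1, v.1 = i
  set Q : Finset (Fin n) := Finset.univ.filter fun j => ∃ e ∈ K, ∀ v ∈ e.1, v.2 = j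
  have hex : ∀ e : (gridGraph n).edgeSet, ∃ v, v ∈ e.1 := by
    rintro ⟨e, he⟩
    induction e using Sym2.ind with | _ a b =>
    exact ⟨a, by simp⟩
  choose w hw using hex
  have hR : R.card ≤ K.card := by
    refine (Finset.card_le_card (t := K.image fun e => (w e).1) fun i hi => ?_).trans
      Finset.card_image_le
    obtain ⟨e, he, h⟩ := (Finset.mem_filter.1 hi).2
    exact Finset.mem_image.2 ⟨e, he, h _ (hw e)⟩
  have hQ : Q.card ≤ K.card := by
    refine (Finset.card_le_card (t := K.image fun e => (w e).2) fun i hi => ?_).trans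
      Finset.card_image_le
    obtain ⟨e, he, h⟩ := (Finset.mem_filter.1 hi).2
    exact Finset.mem_image.2 ⟨e, he, h _ (hw e)⟩
  have hmul : ∀ a b : ℤˣ, a * b ≠ -1 → a = b := by decide
  have hRconst : ∀ i ∉ R, ∀ j j', s (i, j) = s (i, j') := by
    intro i hi
    have key : ∀ j : ℕ, ∀ hj : j < n, s (i, ⟨j, hj⟩) = s (i, ⟨0, by omega⟩) := by
      intro j
      induction j with
      | zero => intro _; rfl
      | succ j ih =>
        intro hj
        rw [← ih (by omega)]
        refine (hmul _ _ fun h => hi ?_).symm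
        simp only [R, Finset.mem_filter, Finset.mem_univ, true_and]
        exact ⟨colEdge i.1 j i.2 hj, mem_cut.2 h, by simp [colEdge]⟩
    intro j j'
    exact (key j.1 j.2).trans (key j'.1 j'.2).symm
  have hQconst : ∀ j ∉ Q, ∀ i i', s (i, j) = s (i', j) := by
    intro j hj
    have key : ∀ i : ℕ, ∀ hi : i < n, s (⟨i, hi⟩, j) = s (⟨0, by omega⟩, j) := by
      intro i
      induction i with
      | zero => intro _; rfl
      | succ i ih =>
        intro hi
        rw [← ih (by omega)]
        refine (hmul _ _ fun h => hj ?_).symm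
        simp only [Q, Finset.mem_filter, Finset.mem_univ, true_and]
        exact ⟨rowEdge i j.1 hi j.2, mem_cut.2 h, by simp [rowEdge]⟩
    intro i i'
    exact (key i.1 i.2).trans (key i'.1 i'.2).symm
  obtain ⟨i0, hi0⟩ : ∃ i, i ∉ R := by
    by_contra! h
    have : R = Finset.univ := Finset.eq_univ_iff_forall.2 h
    rw [this, Finset.card_univ, Fintype.card_fin] at hR
    omega
  obtain ⟨j0, hj0⟩ : ∃ j, j ∉ Q := by
    by_contra! h
    have : Q = Finset.univ := Finset.eq_univ_iff_forall.2 h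
    rw [this, Finset.card_univ, Fintype.card_fin] at hQ
    omega
  have hsub : ∀ v, s v ≠ s (i0, j0) → v ∈ R ×ˢ Q := by
    rintro ⟨i, j⟩ hv
    rw [Finset.mem_product]
    constructor
    · by_contra h
      exact hv ((hRconst i h j j0).trans (hQconst j0 hj0 i i0))
    · by_contra h
      exact hv ((hQconst j h i i0).trans (hRconst i0 hi0 j j0))
  have hcard : (Finset.univ.filter fun v => s v ≠ s (i0, j0)).card ≤ K.card ^ 2 := by
    refine (Finset.card_le_card (t := R ×ˢ Q) fun v hv => hsub v (by simpa using hv)).trans ?_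
    rw [Finset.card_product, sq]
    gcongr
  refine le_trans ?_ hcard
  rcases Int.units_eq_one_or (s (i0, j0)) with h | h
  · refine (min_le_left _ _).trans (Finset.card_le_card fun v => ?_)
    simp only [Finset.mem_filter, Finset.mem_univ, true_and, h]
    intro hv; rw [hv]; decide
  · refine (min_le_right _ _).trans (Finset.card_le_card fun v => ?_)
    simp only [Finset.mem_filter, Finset.mem_univ, true_and, h, Pi.neg_apply]
    intro hv hv'; rw [hv'] at hv; exact absurd hv (by decide)

end Grid

/-! ### Dual cycles and paths as elementary cuts, and their number -/

section Dual

variable {n : ℕ}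

variable (n) in
/-- The planar dual of the grid, with the outer face cut open. -/
def dualGraph : SimpleGraph (ℕ × ℕ) := SimpleGraph.fromEdgeSet (Set.range (dualEdge (n := n)))

/-- The part of the dual graph that crosses the cut of `s`. -/
noncomputable def cutGraph (s : Labeling (Fin n × Fin n)) : SimpleGraph (ℕ × ℕ) :=
  SimpleGraph.fromEdgeSet (dualEdge '' (cut (gridGraph n) s : Set (gridGraph n).edgeSet))

/-- The faces that are not unit squares of the grid. -/
def IsOuterFace (n : ℕ) (x : ℕ × ℕ) : Prop := x.1 = 0 ∨ n ≤ x.1 ∨ x.2 = 0 ∨ n ≤ x.2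

/-- The four neighbours of a face. -/
def faceNeighbors (x : ℕ × ℕ) : Finset (ℕ × ℕ) :=
  {(x.1 + 1, x.2), (x.1 - 1, x.2), (x.1, x.2 + 1), (x.1, x.2 - 1)}

/-- Truncated subtraction makes a face with a coordinate `0` its own neighbour; symmetry and the
bound of four survive this. -/
lemma mem_faceNeighbors_comm (v w : ℕ × ℕ) (h : v ∈ faceNeighbors w) : w ∈ faceNeighbors v := by
  obtain ⟨a, b⟩ := v
  obtain ⟨c, d⟩ := w
  simp only [faceNeighbors, Finset.mem_insert, Finset.mem_singleton, Prod.mk.injEq] at h ⊢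
  omega

lemma card_faceNeighbors_le (v : ℕ × ℕ) : (faceNeighbors v).card ≤ 3 + 1 := Finset.card_le_four

/-- Coordinates turn adjacency questions into linear arithmetic. -/
lemma dualGraph_adj_iff {x y : ℕ × ℕ} : (dualGraph n).Adj x y ↔
    ((x.1 = y.1 ∧ 1 ≤ x.1 ∧ x.1 < n ∧ (x.2 + 1 = y.2 ∧ x.2 < n ∨ y.2 + 1 = x.2 ∧ y.2 < n)) ∨
      x.2 = y.2 ∧ 1 ≤ x.2 ∧ x.2 < n ∧ (x.1 + 1 = y.1 ∧ x.1 < n ∨ y.1 + 1 = x.1 ∧ y.1 < n)) := by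
  obtain ⟨a, b⟩ := x
  obtain ⟨c, d⟩ := y
  simp only [dualGraph, SimpleGraph.fromEdgeSet_adj, Set.mem_range]
  constructor
  · rintro ⟨⟨e, he⟩, -⟩
    rcases eq_rowEdge_or_eq_colEdge e with ⟨i, j, hi, hj, rfl⟩ | ⟨i, j, hi, hj, rfl⟩ <;>
    simp only [dualEdge_rowEdge, dualEdge_colEdge, Sym2.eq_iff, Prod.mk.injEq] at he <;> omega
  · rintro (⟨rfl, h1, h2, ⟨rfl, h3⟩ | ⟨rfl, h3⟩⟩ | ⟨rfl, h1, h2, ⟨rfl, h3⟩ | ⟨rfl, h3⟩⟩)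
    · obtain ⟨a, rfl⟩ := Nat.exists_eq_add_of_le' h1
      exact ⟨⟨rowEdge a b h2 h3, dualEdge_rowEdge ..⟩, by simp⟩
    · obtain ⟨a, rfl⟩ := Nat.exists_eq_add_of_le' h1
      exact ⟨⟨rowEdge a d h2 h3, by rw [dualEdge_rowEdge, Sym2.eq_swap]⟩, by simp⟩
    · obtain ⟨b, rfl⟩ := Nat.exists_eq_add_of_le' h1
      exact ⟨⟨colEdge a b h3 h2, dualEdge_colEdge ..⟩, by simp⟩
    · obtain ⟨b, rfl⟩ := Nat.exists_eq_add_of_le' h1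
      exact ⟨⟨colEdge c b h3 h2, by rw [dualEdge_colEdge, Sym2.eq_swap]⟩, by simp⟩

lemma mem_faceNeighbors_of_dualGraph_adj (x y : ℕ × ℕ) (h : (dualGraph n).Adj x y) :
    x ∈ faceNeighbors y := by
  obtain ⟨a, b⟩ := x
  obtain ⟨c, d⟩ := y
  rw [dualGraph_adj_iff] at h
  simp only [faceNeighbors, Finset.mem_insert, Finset.mem_singleton, Prod.mk.injEq] at h ⊢
  omega

lemma mem_product_of_dualGraph_adj {x y : ℕ × ℕ} (h : (dualGraph n).Adj x y) :
    x ∈ Finset.range (n + 1) ×ˢ Finset.range (n + 1) := by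
  rw [dualGraph_adj_iff] at h
  simp only [Finset.mem_product, Finset.mem_range]
  omega

lemma cutGraph_le (s : Labeling (Fin n × Fin n)) : cutGraph s ≤ dualGraph n :=
  SimpleGraph.fromEdgeSet_mono (Set.image_subset_range _ _)

lemma exists_of_mem_edgeSet_cutGraph {s : Labeling (Fin n × Fin n)} {e : Sym2 (ℕ × ℕ)}
    (he : e ∈ (cutGraph s).edgeSet) : ∃ f ∈ cut (gridGraph n) s, dualEdge f = e := by
  rw [cutGraph, SimpleGraph.edgeSet_fromEdgeSet] at he
  exact he.1

instance (s : Labeling (Fin n × Fin n)) : Finite (cutGraph s).edgeSet := by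
  refine Set.Finite.subset (s := dualEdge '' (cut (gridGraph n) s : Set (gridGraph n).edgeSet))
    (Set.toFinite _) fun e he => ?_
  obtain ⟨f, hf, rfl⟩ := exists_of_mem_edgeSet_cutGraph he
  exact ⟨f, hf, rfl⟩

lemma cutGraph_adj_of_mem_cut {s : Labeling (Fin n × Fin n)} {e : (gridGraph n).edgeSet}
    {x y : ℕ × ℕ} (he : edgeSign s e = -1) (h : dualEdge e = s(x, y)) : (cutGraph s).Adj x y := by
  have hd : (dualGraph n).edgeSet = Set.range (dualEdge (n := n)) := by
    rw [dualGraph, SimpleGraph.edgeSet_fromEdgeSet, sdiff_eq_left, Set.disjoint_left]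
    rintro _ ⟨e, rfl⟩ h
    rcases eq_rowEdge_or_eq_colEdge e with ⟨i, j, hi, hj, rfl⟩ | ⟨i, j, hi, hj, rfl⟩ <;>
    simp [dualEdge_rowEdge, dualEdge_colEdge] at h
  have hne : x ≠ y := by
    have : (dualGraph n).Adj x y := by
      rw [← SimpleGraph.mem_edgeSet, hd]
      exact ⟨e, h⟩
    exact this.ne
  rw [cutGraph, SimpleGraph.fromEdgeSet_adj]
  exact ⟨⟨e, mem_cut.2 he, h⟩, hne⟩

/-- A cut crosses every unit square an even number of times, so it never crosses it just once. -/
lemma cutGraph_two_neighbors (s : Labeling (Fin n × Fin n)) (x y : ℕ × ℕ)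
    (hx : ¬ IsOuterFace n x) (hxy : (cutGraph s).Adj x y) :
    ∃ z, z ≠ y ∧ (cutGraph s).Adj x z := by
  obtain ⟨a, b⟩ := x
  simp only [IsOuterFace, not_or, not_le] at hx
  obtain ⟨ha, ha', hb, hb'⟩ := hx
  obtain ⟨i, rfl⟩ := Nat.exists_eq_succ_of_ne_zero ha
  obtain ⟨j, rfl⟩ := Nat.exists_eq_succ_of_ne_zero hb
  simp only [Nat.succ_eq_add_one] at *
  have hi : i < n := by omega
  have hj : j < n := by omega
  have h1 : edgeSign s (rowEdge i j ha' hj) = -1 → (cutGraph s).Adj (i + 1, j + 1) (i + 1, j) :=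
    fun h => cutGraph_adj_of_mem_cut h (by rw [dualEdge_rowEdge, Sym2.eq_swap])
  have h2 : edgeSign s (rowEdge i (j + 1) ha' hb') = -1 →
      (cutGraph s).Adj (i + 1, j + 1) (i + 1, j + 2) :=
    fun h => cutGraph_adj_of_mem_cut h (by rw [dualEdge_rowEdge])
  have h3 : edgeSign s (colEdge i j hi hb') = -1 → (cutGraph s).Adj (i + 1, j + 1) (i, j + 1) :=
    fun h => cutGraph_adj_of_mem_cut h (by rw [dualEdge_colEdge, Sym2.eq_swap])
  have h4 : edgeSign s (colEdge (i + 1) j ha' hb') = -1 →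
      (cutGraph s).Adj (i + 1, j + 1) (i + 2, j + 1) :=
    fun h => cutGraph_adj_of_mem_cut h (by rw [dualEdge_colEdge])
  -- Each corner of the square lies on two of its four sides, so every label occurs squared.
  have hprod : edgeSign s (rowEdge i j ha' hj) * edgeSign s (rowEdge i (j + 1) ha' hb') *
      edgeSign s (colEdge i j hi hb') * edgeSign s (colEdge (i + 1) j ha' hb') = 1 := by
    simp only [edgeSign_rowEdge, edgeSign_colEdge]
    generalize s (⟨i, _⟩, ⟨j, _⟩) = a
    generalize s (⟨i + 1, _⟩, ⟨j, _⟩) = b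
    generalize s (⟨i, _⟩, ⟨j + 1, _⟩) = c
    generalize s (⟨i + 1, _⟩, ⟨j + 1, _⟩) = d
    revert a b c d
    decide
  have hsign : edgeSign s (rowEdge i j ha' hj) = -1 ∧ y = (i + 1, j) ∨
      edgeSign s (rowEdge i (j + 1) ha' hb') = -1 ∧ y = (i + 1, j + 2) ∨
      edgeSign s (colEdge i j hi hb') = -1 ∧ y = (i, j + 1) ∨
      edgeSign s (colEdge (i + 1) j ha' hb') = -1 ∧ y = (i + 2, j + 1) := by
    obtain ⟨e, he, hey⟩ := exists_of_mem_edgeSet_cutGraph ((SimpleGraph.mem_edgeSet _).2 hxy)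
    rw [mem_cut] at he
    obtain ⟨c, d⟩ := y
    rcases eq_rowEdge_or_eq_colEdge e with ⟨k, l, hk, hl, rfl⟩ | ⟨k, l, hk, hl, rfl⟩ <;>
    simp only [dualEdge_rowEdge, dualEdge_colEdge, Sym2.eq_iff, Prod.mk.injEq] at hey
    · obtain ⟨rfl, rfl, rfl, rfl⟩ | ⟨rfl, rfl, rfl, rfl⟩ :
        (k = i ∧ l = j + 1 ∧ c = i + 1 ∧ d = j + 2) ∨ (k = i ∧ l = j ∧ c = i + 1 ∧ d = j) := by
        omega
      · exact Or.inr (Or.inl ⟨he, rfl⟩)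
      · exact Or.inl ⟨he, rfl⟩
    · obtain ⟨rfl, rfl, rfl, rfl⟩ | ⟨rfl, rfl, rfl, rfl⟩ :
        (k = i + 1 ∧ l = j ∧ c = i + 2 ∧ d = j + 1) ∨ (k = i ∧ l = j ∧ c = i ∧ d = j + 1) := by
        omega
      · exact Or.inr (Or.inr (Or.inr ⟨he, rfl⟩))
      · exact Or.inr (Or.inr (Or.inl ⟨he, rfl⟩))
  generalize edgeSign s (rowEdge i j ha' hj) = A at *
  generalize edgeSign s (rowEdge i (j + 1) ha' hb') = B at *
  generalize edgeSign s (colEdge i j hi hb') = C at *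
  generalize edgeSign s (colEdge (i + 1) j ha' hb') = D at *
  have hcases : ∀ A B C D : ℤˣ, A * B * C * D = 1 →
      (A = -1 → B = -1 ∨ C = -1 ∨ D = -1) ∧ (B = -1 → A = -1 ∨ C = -1 ∨ D = -1) ∧
      (C = -1 → A = -1 ∨ B = -1 ∨ D = -1) ∧ (D = -1 → A = -1 ∨ B = -1 ∨ C = -1) := by decide
  obtain ⟨c1, c2, c3, c4⟩ := hcases A B C D hprod
  rcases hsign with ⟨h, rfl⟩ | ⟨h, rfl⟩ | ⟨h, rfl⟩ | ⟨h, rfl⟩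
  · rcases c1 h with h | h | h
    exacts [⟨_, by simp, h2 h⟩, ⟨_, by simp, h3 h⟩, ⟨_, by simp, h4 h⟩]
  · rcases c2 h with h | h | h
    exacts [⟨_, by simp, h1 h⟩, ⟨_, by simp, h3 h⟩, ⟨_, by simp, h4 h⟩]
  · rcases c3 h with h | h | h
    exacts [⟨_, by simp, h1 h⟩, ⟨_, by simp, h2 h⟩, ⟨_, by simp, h4 h⟩]
  · rcases c4 h with h | h | h
    exacts [⟨_, by simp, h1 h⟩, ⟨_, by simp, h2 h⟩, ⟨_, by simp, h3 h⟩]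

lemma prod_faceNeighbors (g : Sym2 (ℕ × ℕ) → ℤˣ) (i j : ℕ) :
    ∏ y ∈ faceNeighbors (i + 1, j + 1), g s((i + 1, j + 1), y) =
      g s((i + 1, j), (i + 1, j + 1)) * g s((i + 1, j + 1), (i + 1, j + 2)) *
        g s((i, j + 1), (i + 1, j + 1)) * g s((i + 1, j + 1), (i + 2, j + 1)) := by
  have h : faceNeighbors (i + 1, j + 1) =
      {(i + 2, j + 1), (i, j + 1), (i + 1, j + 2), (i + 1, j)} := rfl
  rw [h, Finset.prod_insert (by simp), Finset.prod_insert (by simp),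
    Finset.prod_insert (by simp), Finset.prod_singleton, Sym2.eq_swap (a := (i + 1, j)),
    Sym2.eq_swap (a := (i, j + 1))]
  generalize g s((i + 1, j + 1), (i + 2, j + 1)) = a
  generalize g s((i + 1, j + 1), (i, j + 1)) = b
  generalize g s((i + 1, j + 1), (i + 1, j + 2)) = c
  generalize g s((i + 1, j + 1), (i + 1, j)) = d
  revert a b c d
  decide

/-- The trail uses an even number of edges at every vertex that is not one of its endpoints. -/
lemma even_card_filter_faceNeighbors {u v : ℕ × ℕ} {p : (dualGraph n).Walk u v}
    (hp : p.IsTrail) (x : ℕ × ℕ) (hx : u ≠ v → x ≠ u ∧ x ≠ v) :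
    Even ((faceNeighbors x).filter fun y => s(x, y) ∈ p.edges).card := by
  have heven := (hp.even_countP_edges_iff x).2 hx
  rw [List.countP_eq_length_filter, ← List.toFinset_card_of_nodup (hp.edges_nodup.filter _)]
    at heven
  rw [← Finset.card_image_of_injective _ (f := fun y => s(x, y))
    (fun a b h => Sym2.congr_right.1 h)]
  convert heven using 2
  ext e
  simp only [List.mem_toFinset, List.mem_filter, decide_eq_true_eq, Finset.mem_image,
    Finset.mem_filter]
  constructor
  · rintro ⟨y, ⟨-, h⟩, rfl⟩
    exact ⟨h, by simp⟩
  · rintro ⟨he, hx⟩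
    obtain ⟨y, rfl⟩ := Sym2.mem_iff_exists.1 hx
    exact ⟨y, ⟨mem_faceNeighbors_comm _ _
      (mem_faceNeighbors_of_dualGraph_adj _ _ (p.adj_of_mem_edges he)), he⟩, rfl⟩

/-- A dual trail that is closed or joins two outer faces is the cut of a labeling. -/
lemma exists_cut_of_isTrail {u v : ℕ × ℕ} (p : (dualGraph n).Walk u v) (hp : p.IsTrail)
    (huv : u ≠ v → IsOuterFace n u ∧ IsOuterFace n v) :
    ∃ t : Labeling (Fin n × Fin n), (cut (gridGraph n) t).image dualEdge = p.edges.toFinset := by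
  -- The product is `-1` to the number of trail edges at the face. That number is even, because a
  -- unit square is never an endpoint of an open trail here.
  have hg : ∀ i j, i + 1 < n → j + 1 < n → ∏ y ∈ faceNeighbors (i + 1, j + 1),
      (if s((i + 1, j + 1), y) ∈ p.edges then (-1 : ℤˣ) else 1) = 1 := by
    intro i j hi hj
    rw [Finset.prod_ite, Finset.prod_const, Finset.prod_const_one, mul_one]
    refine (even_card_filter_faceNeighbors hp _ fun h => ?_).neg_one_pow
    obtain ⟨hu, hv⟩ := huv h
    constructor <;> rintro rfl <;> simp only [IsOuterFace] at hu hv <;> omega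
  obtain ⟨t, ht⟩ := exists_labeling_of_square_prod_eq_one (n := n)
    (fun e => if e ∈ p.edges then -1 else 1) fun i j hi hj => by
      have h := hg i j hi hj
      rw [prod_faceNeighbors fun e => if e ∈ p.edges then (-1 : ℤˣ) else 1] at h
      exact h
  refine ⟨t, ?_⟩
  ext e
  simp only [Finset.mem_image, mem_cut, ht, List.mem_toFinset]
  constructor
  · rintro ⟨f, hf, rfl⟩
    by_contra h
    simp [h] at hf
  · intro he
    have h := p.edges_subset_edgeSet he
    rw [dualGraph, SimpleGraph.edgeSet_fromEdgeSet] at h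
    obtain ⟨⟨f, rfl⟩, -⟩ := h
    exact ⟨f, by simp [he], rfl⟩

/-- Edge sets dual to a cycle of unit squares. -/
def IsCycleCut (F : Finset (gridGraph n).edgeSet) : Prop :=
  ∃ (u : ℕ × ℕ) (c : (dualGraph n).Walk u u), c.IsCycle ∧ F.image dualEdge = c.edges.toFinset

/-- Edge sets dual to a path between two outer faces. -/
def IsPathCut (F : Finset (gridGraph n).edgeSet) : Prop :=
  ∃ (u v : ℕ × ℕ) (p : (dualGraph n).Walk u v), p.IsPath ∧ u ≠ v ∧ IsOuterFace n u ∧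
    IsOuterFace n v ∧ F.image dualEdge = p.edges.toFinset

lemma card_eq_length_of_image_eq {F : Finset (gridGraph n).edgeSet} {u v : ℕ × ℕ}
    {p : (dualGraph n).Walk u v} (hp : p.IsTrail) (h : F.image dualEdge = p.edges.toFinset) :
    F.card = p.length := by
  rw [← Finset.card_image_of_injective F dualEdge_injective, h,
    List.toFinset_card_of_nodup hp.edges_nodup, SimpleGraph.Walk.length_edges]

/-- Three edges are enough for the factor `p ^ 2`: half of three, rounded up, is two. -/
lemma IsCycleCut.three_le_card {F : Finset (gridGraph n).edgeSet} (h : IsCycleCut F) :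
    3 ≤ F.card := by
  obtain ⟨u, c, hc, hF⟩ := h
  rw [card_eq_length_of_image_eq hc.isTrail hF]
  exact hc.three_le_length

lemma IsPathCut.one_le_card {F : Finset (gridGraph n).edgeSet} (h : IsPathCut F) :
    1 ≤ F.card := by
  obtain ⟨u, v, p, hp, huv, -, -, hF⟩ := h
  rw [card_eq_length_of_image_eq hp.isTrail hF]
  by_contra! hlt
  exact huv (SimpleGraph.Walk.eq_of_length_eq_zero (p := p) (by omega))

/-- Every nonempty cut contains a cut dual to a cycle or to a path between outer faces. -/
lemma exists_elementary_cut_subset {s : Labeling (Fin n × Fin n)}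
    (hs : (cut (gridGraph n) s).Nonempty) :
    ∃ t, cut (gridGraph n) t ⊆ cut (gridGraph n) s ∧
      (IsCycleCut (cut (gridGraph n) t) ∨ IsPathCut (cut (gridGraph n) t)) := by
  have hsub : ∀ {u v} (p : (cutGraph s).Walk u v) (t : Labeling (Fin n × Fin n)),
      (cut (gridGraph n) t).image dualEdge = (p.mapLe (cutGraph_le s)).edges.toFinset →
      cut (gridGraph n) t ⊆ cut (gridGraph n) s := by
    intro u v p t h e he
    have h1 : dualEdge e ∈ (p.mapLe (cutGraph_le s)).edges.toFinset :=
      h ▸ Finset.mem_image_of_mem _ he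
    rw [List.mem_toFinset, SimpleGraph.Walk.edges_mapLe_eq_edges] at h1
    obtain ⟨f, hf, hfe⟩ := exists_of_mem_edgeSet_cutGraph (p.edges_subset_edgeSet h1)
    rwa [← dualEdge_injective hfe]
  have hne : (cutGraph s).edgeSet.Nonempty := by
    obtain ⟨e, he⟩ := hs
    obtain ⟨x, y, hxy⟩ : ∃ x y, dualEdge e = s(x, y) := by
      induction h : dualEdge e using Sym2.ind with | _ a b =>
      exact ⟨a, b, rfl⟩
    exact ⟨s(x, y), cutGraph_adj_of_mem_cut (mem_cut.1 he) hxy⟩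
  rcases exists_isCycle_or_isPath_of_two_neighbors (cutGraph s) (IsOuterFace n)
    (cutGraph_two_neighbors s) hne with ⟨u, c, hc⟩ | ⟨u, v, p, hp, huv, hu, hv⟩
  · have hc' := hc.mapLe (cutGraph_le s)
    obtain ⟨t, ht⟩ := exists_cut_of_isTrail _ hc'.isTrail fun h => absurd rfl h
    exact ⟨t, hsub c t ht, Or.inl ⟨u, _, hc', ht⟩⟩
  · have hp' := hp.mapLe (cutGraph_le s)
    obtain ⟨t, ht⟩ := exists_cut_of_isTrail _ hp'.isTrail fun _ => ⟨hu, hv⟩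
    exact ⟨t, hsub p t ht, Or.inr ⟨u, v, _, hp', huv, hu, hv, ht⟩⟩

open Classical in
variable (n) in
/-- The cuts dual to cycles or to paths between outer faces. -/
noncomputable def elementaryCuts : Finset (Finset (gridGraph n).edgeSet) :=
  {F | (IsCycleCut F ∨ IsPathCut F) ∧ ∃ t, F = cut (gridGraph n) t}

lemma nonempty_of_mem_elementaryCuts {F : Finset (gridGraph n).edgeSet}
    (hF : F ∈ elementaryCuts n) : F.Nonempty := by
  simp only [elementaryCuts, Finset.mem_filter, Finset.mem_univ, true_and] at hF
  rw [← Finset.card_pos]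
  rcases hF.1 with h | h
  · have := h.three_le_card
    omega
  · exact h.one_le_card

open Classical in
/-- The smaller side of a cut is controlled by the elementary cuts that the cut contains. -/
lemma minority_le_sum_elementaryCuts (s : Labeling (Fin n × Fin n)) :
    minority s ≤ ∑ F ∈ (elementaryCuts n).filter (· ⊆ cut (gridGraph n) s), F.card ^ 2 := by
  induction hk : (cut (gridGraph n) s).card using Nat.strong_induction_on generalizing s with
  | _ k ih =>
  by_cases hs : (cut (gridGraph n) s).Nonempty
  swap
  · have h := minority_le_card_cut_sq s
    rw [Finset.not_nonempty_iff_eq_empty.1 hs] at h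
    simp only [Finset.card_empty] at h
    omega
  -- Peel off one elementary cut. The labeling `s * t` has the strictly smaller cut `cut s \ cut t`,
  -- and the nonempty `cut t`, not contained in it, is a new term of the sum.
  obtain ⟨t, hts, ht⟩ := exists_elementary_cut_subset hs
  have htF : cut (gridGraph n) t ∈ elementaryCuts n := by
    simp only [elementaryCuts, Finset.mem_filter, Finset.mem_univ, true_and]
    exact ⟨ht, t, rfl⟩
  have hne := nonempty_of_mem_elementaryCuts htF
  have hcut := cut_mul_eq_sdiff hts
  have hst : s = s * t * t := by
    rw [mul_assoc]
    ext v
    simp [Int.units_mul_self]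
  have h1 := ih _ (by
    rw [hcut, ← hk]
    exact Finset.card_lt_card (Finset.sdiff_ssubset hts hne)) (s * t) rfl
  calc minority s ≤ minority (s * t) + minority t := by
        conv_lhs => rw [hst]
        exact minority_mul_le _ _
    _ ≤ (∑ F ∈ (elementaryCuts n).filter (· ⊆ cut (gridGraph n) (s * t)), F.card ^ 2) +
        (cut (gridGraph n) t).card ^ 2 := add_le_add h1 (minority_le_card_cut_sq t)
    _ = ∑ F ∈ insert (cut (gridGraph n) t)
        ((elementaryCuts n).filter (· ⊆ cut (gridGraph n) (s * t))), F.card ^ 2 := by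
        rw [Finset.sum_insert, add_comm]
        rw [Finset.mem_filter, hcut]
        rintro ⟨-, h⟩
        obtain ⟨e, he⟩ := hne
        exact (Finset.mem_sdiff.1 (h he)).2 he
    _ ≤ _ := by
        refine Finset.sum_le_sum_of_subset fun F hF => ?_
        rw [Finset.mem_insert, Finset.mem_filter] at hF
        rw [Finset.mem_filter]
        rcases hF with rfl | ⟨hF, h⟩
        · exact ⟨htF, hts⟩
        · exact ⟨hF, h.trans (hcut ▸ Finset.sdiff_subset)⟩

open Classical in
-- The base point may be any of the `(n + 1) ^ 2` faces.
lemma card_isCycleCut_le (k : ℕ) :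
    (Finset.univ.filter fun F : Finset (gridGraph n).edgeSet =>
      IsCycleCut F ∧ F.card = k + 2).card ≤ (n + 1) ^ 2 * 4 * 3 ^ k := by
  have h := card_cycleEdgeSets_le (Finset.range (n + 1) ×ˢ Finset.range (n + 1))
    (mem_faceNeighbors_of_dualGraph_adj (n := n)) mem_faceNeighbors_comm
    card_faceNeighbors_le k ((Finset.univ.filter fun F : Finset (gridGraph n).edgeSet =>
      IsCycleCut F ∧ F.card = k + 2).image (Finset.image dualEdge)) (by
      intro F' hF'
      obtain ⟨F, hF, rfl⟩ := Finset.mem_image.1 hF'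
      obtain ⟨⟨u, c, hc, hFc⟩, hk⟩ := (Finset.mem_filter.1 hF).2
      refine ⟨u, c, hc, ?_, ?_, hFc⟩
      · exact mem_product_of_dualGraph_adj (c.adj_snd hc.not_nil)
      · rw [← hk, card_eq_length_of_image_eq hc.isTrail hFc])
  rw [Finset.card_image_of_injective _ (Finset.image_injective dualEdge_injective)] at h
  refine h.trans (le_of_eq ?_)
  simp [sq]

open Classical in
-- A path ends on the boundary of the box of faces, which leaves only `O(n)` end points. This
-- compensates for paths carrying a single factor `p`.
lemma card_isPathCut_le (k : ℕ) :
    (Finset.univ.filter fun F : Finset (gridGraph n).edgeSet =>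
      IsPathCut F ∧ F.card = k + 1).card ≤ 4 * (n + 1) * 4 * 3 ^ k := by
  set St : Finset (ℕ × ℕ) := ({0, n} ×ˢ Finset.range (n + 1)) ∪ (Finset.range (n + 1) ×ˢ {0, n})
  have hSt : St.card ≤ 4 * (n + 1) := by
    refine (Finset.card_union_le _ _).trans ?_
    rw [Finset.card_product, Finset.card_product, Finset.card_range]
    have : ({0, n} : Finset ℕ).card ≤ 2 := Finset.card_le_two
    nlinarith
  have h := card_pathEdgeSets_le St
    (mem_faceNeighbors_of_dualGraph_adj (n := n)) mem_faceNeighbors_comm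
    card_faceNeighbors_le k ((Finset.univ.filter fun F : Finset (gridGraph n).edgeSet =>
      IsPathCut F ∧ F.card = k + 1).image (Finset.image dualEdge)) (by
      intro F' hF'
      obtain ⟨F, hF, rfl⟩ := Finset.mem_image.1 hF'
      obtain ⟨⟨u, v, p, hp, huv, hu, hv, hFp⟩, hk⟩ := (Finset.mem_filter.1 hF).2
      refine ⟨u, v, p, hp, ?_, ?_, hFp⟩
      · have := mem_product_of_dualGraph_adj
          (p.adj_penultimate (fun h => huv (hp.nil_iff_eq.1 h))).symm
        simp only [IsOuterFace] at hv
        simp only [St, Finset.mem_union, Finset.mem_product, Finset.mem_insert,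
          Finset.mem_singleton, Finset.mem_range] at this ⊢
        omega
      · rw [← hk, card_eq_length_of_image_eq hp.isTrail hFp])
  rw [Finset.card_image_of_injective _ (Finset.image_injective dualEdge_injective)] at h
  refine h.trans ?_
  gcongr

end Dual

/-! ### Summing the weights of elementary cuts -/

section Series

lemma sum_comp_le_tsum {α : Type*} (A : Finset α) (f : α → ℕ) (w b : ℕ → ℝ) (hb : Summable b)
    (hb0 : ∀ i, 0 ≤ b i) (h : ∀ i, ((A.filter fun a => f a = i).card : ℝ) * w i ≤ b i) :
    ∑ a ∈ A, w (f a) ≤ ∑' i, b i := by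
  rw [Finset.sum_comp w f]
  refine le_trans (Finset.sum_le_sum fun i _ => ?_) (hb.sum_le_tsum (A.image f) fun i _ => hb0 i)
  rw [nsmul_eq_mul]
  exact h i

/-- The constant `ρ = 0.1602` satisfies `1 / 39 ≤ ρ ^ 2` and `6 * ρ < 1`. -/
lemma pow_half_le {p : ℝ} (hp : 0 < p) (hp' : p < 1 / 39) {i m : ℕ} (hm : m ≤ (i + 1) / 2) :
    p ^ ((i + 1) / 2) ≤ p ^ m * 39 ^ m * (1602 / 10000 : ℝ) ^ i := by
  set k := (i + 1) / 2
  -- Keep `m` factors `p` and bound the others by `1 / 39`; the factor `39 ^ m` makes up for the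
  -- kept ones.
  have h1 : p ^ k = p ^ m * p ^ (k - m) := by rw [← pow_add]; congr 1; omega
  have h2 : (1 / 39 : ℝ) ^ (k - m) = 39 ^ m * (1 / 39 : ℝ) ^ k := by
    obtain ⟨d, hd⟩ := Nat.exists_eq_add_of_le hm
    rw [hd, Nat.add_sub_cancel_left, pow_add, ← mul_assoc, ← mul_pow]
    norm_num
  have h3 : (1 / 39 : ℝ) ^ k ≤ (1602 / 10000 : ℝ) ^ i := by
    calc (1 / 39 : ℝ) ^ k ≤ ((1602 / 10000 : ℝ) ^ 2) ^ k := by gcongr; norm_num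
      _ = (1602 / 10000 : ℝ) ^ (2 * k) := by rw [pow_mul]
      _ ≤ _ := pow_le_pow_of_le_one (by norm_num) (by norm_num) (by omega)
  calc p ^ k = p ^ m * p ^ (k - m) := h1
    _ ≤ p ^ m * (1 / 39) ^ (k - m) := by gcongr
    _ = p ^ m * 39 ^ m * (1 / 39) ^ k := by rw [h2]; ring
    _ ≤ _ := by gcongr

/-- The ratio is `3 * 2 * 0.1602`: `3` from counting walks, `2` from choosing the corrupted edges,
`0.1602` from the noise. -/
lemma summable_sq_mul_geometric : Summable fun i : ℕ => (i : ℝ) ^ 2 * (9612 / 10000 : ℝ) ^ i :=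
  summable_pow_mul_geometric_of_norm_lt_one 2 (by norm_num [abs_of_pos])

/-- A family of `c * 3 ^ i` sets of each size `i`, each at least half corrupted, contributes
`O(c * p ^ m)`. -/
lemma sum_weight_le {α : Type*} (A : Finset α) (f : α → ℕ) {c : ℝ} (hc : 0 ≤ c) {p : ℝ}
    (hp : 0 < p) (hp' : p < 1 / 39) (m : ℕ) (hm : ∀ a ∈ A, m ≤ (f a + 1) / 2)
    (h : ∀ i, m ≤ (i + 1) / 2 → ((A.filter fun a => f a = i).card : ℝ) ≤ c * 3 ^ i) :
    ∑ a ∈ A, (f a : ℝ) ^ 2 * (2 ^ f a * p ^ ((f a + 1) / 2)) ≤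
      c * 39 ^ m * (∑' i : ℕ, (i : ℝ) ^ 2 * (9612 / 10000 : ℝ) ^ i) * p ^ m := by
  refine (sum_comp_le_tsum A f (fun i => (i : ℝ) ^ 2 * (2 ^ i * p ^ ((i + 1) / 2)))
    (fun i => (c * 39 ^ m * p ^ m) * ((i : ℝ) ^ 2 * (9612 / 10000 : ℝ) ^ i))
    (summable_sq_mul_geometric.mul_left _) (fun i => by positivity) fun i => ?_).trans_eq ?_
  · by_cases hi : m ≤ (i + 1) / 2
    · calc _ ≤ (c * 3 ^ i) * ((i : ℝ) ^ 2 * (2 ^ i * (p ^ m * 39 ^ m * (1602 / 10000 : ℝ) ^ i))) := by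
            gcongr
            · exact h i hi
            · exact pow_half_le hp hp' hi
        _ = (c * 39 ^ m * p ^ m) * ((i : ℝ) ^ 2 * (3 ^ i * 2 ^ i * (1602 / 10000 : ℝ) ^ i)) := by
            ring
        _ = _ := by rw [← mul_pow, ← mul_pow]; norm_num
    · rw [Finset.filter_eq_empty_iff.2, Finset.card_empty]
      · rw [Nat.cast_zero, zero_mul]
        positivity
      · rintro a ha rfl
        exact hi (hm a ha)
  · rw [tsum_mul_left]
    ring

lemma exists_sum_elementaryCuts_le : ∃ K : ℝ, 0 ≤ K ∧ ∀ (n : ℕ) (p : ℝ), 0 < p → p < 1 / 39 →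
    ∑ F ∈ elementaryCuts n, (F.card : ℝ) ^ 2 * (2 ^ F.card * p ^ ((F.card + 1) / 2)) ≤
      K * (((n : ℝ) + 1) ^ 2 * p ^ 2 + ((n : ℝ) + 1) * p) := by
  classical
  obtain ⟨T, hTdef⟩ : ∃ T, T = ∑' i : ℕ, (i : ℝ) ^ 2 * (9612 / 10000 : ℝ) ^ i := ⟨_, rfl⟩
  have hT : 0 ≤ T := hTdef ▸ tsum_nonneg fun i => by positivity
  -- The cycles need `4 * 39 ^ 2 * T` and the paths `16 * 39 * T`.
  refine ⟨16 * 39 ^ 2 * T, by positivity, fun n p hp hp' => ?_⟩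
  have hcyc := sum_weight_le (Finset.univ.filter fun F : Finset (gridGraph n).edgeSet =>
    IsCycleCut F) Finset.card (c := ((n : ℝ) + 1) ^ 2 * 4) (by positivity) hp hp' 2 (by
      intro F hF
      have := (Finset.mem_filter.1 hF).2.three_le_card
      omega) (by
      intro i hi
      obtain ⟨k, rfl⟩ := Nat.exists_eq_add_of_le' (show 2 ≤ i by omega)
      rw [Finset.filter_filter]
      have h := card_isCycleCut_le (n := n) k
      calc _ ≤ (((n + 1) ^ 2 * 4 * 3 ^ k : ℕ) : ℝ) := by exact_mod_cast h
        _ ≤ ((n : ℝ) + 1) ^ 2 * 4 * 3 ^ (k + 2) := by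
          push_cast
          gcongr
          · norm_num
          · omega)
  have hpath := sum_weight_le (Finset.univ.filter fun F : Finset (gridGraph n).edgeSet =>
    IsPathCut F) Finset.card (c := 4 * ((n : ℝ) + 1) * 4) (by positivity) hp hp' 1 (by
      intro F hF
      have := (Finset.mem_filter.1 hF).2.one_le_card
      omega) (by
      intro i hi
      obtain ⟨k, rfl⟩ := Nat.exists_eq_add_of_le' (show 1 ≤ i by omega)
      rw [Finset.filter_filter]
      have h := card_isPathCut_le (n := n) k
      calc _ ≤ ((4 * (n + 1) * 4 * 3 ^ k : ℕ) : ℝ) := by exact_mod_cast h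
        _ ≤ 4 * ((n : ℝ) + 1) * 4 * 3 ^ (k + 1) := by
          push_cast
          gcongr
          · norm_num
          · omega)
  have hsub : elementaryCuts n ⊆ (Finset.univ.filter fun F : Finset (gridGraph n).edgeSet =>
      IsCycleCut F) ∪ Finset.univ.filter fun F : Finset (gridGraph n).edgeSet => IsPathCut F := by
    intro F hF
    simp only [elementaryCuts, Finset.mem_filter, Finset.mem_univ, true_and] at hF
    simpa using hF.1
  have hnonneg : ∀ F : Finset (gridGraph n).edgeSet,
      0 ≤ (F.card : ℝ) ^ 2 * (2 ^ F.card * p ^ ((F.card + 1) / 2)) := fun F => by positivity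
  refine (Finset.sum_le_sum_of_subset_of_nonneg hsub fun F _ _ => hnonneg F).trans ?_
  refine (le_trans (le_add_of_nonneg_right (Finset.sum_nonneg fun F _ => hnonneg F))
    (Finset.sum_union_inter).le).trans ?_
  rw [← hTdef] at hcyc hpath
  have h3 : 0 ≤ ((n : ℝ) + 1) ^ 2 * p ^ 2 * T := by positivity
  have h4 : 0 ≤ ((n : ℝ) + 1) * p * T := by positivity
  linarith

end Series

/-! ### Probability estimates for the noise -/

section Noise

instance : MeasurableSingletonClass ℤˣ where
  measurableSet_singleton s := ⟨{(s : ℤ)}, measurableSet_singleton _, by ext; simp [Units.ext_iff]⟩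

lemma isProbabilityMeasure_noisySign {ε : ℝ} (h0 : 0 ≤ ε) (h1 : ε ≤ 1) (s : ℤˣ) :
    IsProbabilityMeasure (noisySign ε s) := by
  constructor
  simp only [noisySign, Measure.add_apply, Measure.smul_apply, measure_univ, smul_eq_mul, mul_one]
  rw [← ENNReal.ofReal_add (by linarith) h0]
  simp

lemma noisySign_neg_singleton (ε : ℝ) (s : ℤˣ) : noisySign ε s {-s} = ENNReal.ofReal ε := by
  have h : s ≠ -s := by revert s; decide
  simp [noisySign, Set.indicator, h]

lemma integral_noisySign {ε : ℝ} (h0 : 0 ≤ ε) (h1 : ε ≤ 1) (s : ℤˣ) (f : ℤˣ → ℝ) :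
    ∫ z, f z ∂(noisySign ε s) = (1 - ε) * f s + ε * f (-s) := by
  have hfin : ∀ (a : ℝ) (t : ℤˣ), IsFiniteMeasure (ENNReal.ofReal a • Measure.dirac t) :=
    fun a t => Measure.smul_finite _ ENNReal.ofReal_ne_top
  have := hfin (1 - ε) s
  have := hfin ε (-s)
  rw [noisySign, integral_add_measure .of_finite .of_finite, integral_smul_measure,
    integral_smul_measure, integral_dirac, integral_dirac,
    ENNReal.toReal_ofReal (by linarith), ENNReal.toReal_ofReal h0]
  rfl

variable {ι : Type*} [Fintype ι]

/-- A set of `k` observations is at least half corrupted with probability at most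
`2 ^ k * p ^ ⌈k / 2⌉`. -/
lemma measureReal_half_corrupted_le {p : ℝ} (h0 : 0 ≤ p) (h1 : p ≤ 1) (s : ι → ℤˣ)
    (F : Finset ι) :
    (Measure.pi fun i => noisySign p (s i)).real
      {x | F.card ≤ 2 * (F.filter fun i => x i = -s i).card} ≤
      2 ^ F.card * p ^ ((F.card + 1) / 2) := by
  classical
  have := fun i => isProbabilityMeasure_noisySign h0 h1 (s i)
  set μ := Measure.pi fun i => noisySign p (s i)
  have hB : ∀ B : Finset ι, μ.real {x | ∀ i ∈ B, x i = -s i} = p ^ B.card := by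
    intro B
    have : {x : ι → ℤˣ | ∀ i ∈ B, x i = -s i} =
        Set.univ.pi fun i => if i ∈ B then {-s i} else Set.univ := by
      ext x
      simp only [Set.mem_ofPred_eq, Set.mem_pi, Set.mem_univ, true_implies]
      refine forall_congr' fun i => ?_
      split_ifs with h <;> simp [h]
    rw [this, Measure.real, Measure.pi_pi]
    have h2 : ∀ i, noisySign p (s i) (if i ∈ B then {-s i} else Set.univ) =
        if i ∈ B then ENNReal.ofReal p else 1 := by
      intro i
      split_ifs
      · exact noisySign_neg_singleton _ _
      · exact measure_univ
    simp only [h2]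
    rw [Finset.prod_ite_mem, Finset.univ_inter, Finset.prod_const, ENNReal.toReal_pow,
      ENNReal.toReal_ofReal h0]
  -- Union bound over the possible corrupted sets: at most `2 ^ F.card` of them, each having at
  -- least half of the elements of `F`.
  set P := F.powerset.filter fun B => (F.card + 1) / 2 ≤ B.card
  have hsub : {x : ι → ℤˣ | F.card ≤ 2 * (F.filter fun i => x i = -s i).card} ⊆
      ⋃ B ∈ P, {x | ∀ i ∈ B, x i = -s i} := by
    intro x hx
    simp only [Set.mem_ofPred_eq] at hx
    simp only [Set.mem_iUnion]
    refine ⟨F.filter fun i => x i = -s i, ?_, fun i hi => (Finset.mem_filter.1 hi).2⟩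
    simp only [P, Finset.mem_filter, Finset.mem_powerset]
    exact ⟨Finset.filter_subset _ _, by omega⟩
  calc _ ≤ μ.real (⋃ B ∈ P, {x | ∀ i ∈ B, x i = -s i}) :=
        measureReal_mono hsub (measure_ne_top _ _)
    _ ≤ ∑ B ∈ P, μ.real {x | ∀ i ∈ B, x i = -s i} := measureReal_biUnion_finset_le _ _
    _ ≤ ∑ B ∈ P, p ^ ((F.card + 1) / 2) := by
        refine Finset.sum_le_sum fun B hBP => ?_
        rw [hB]
        exact pow_le_pow_of_le_one h0 h1 (Finset.mem_filter.1 hBP).2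
    _ ≤ _ := by
        rw [Finset.sum_const, nsmul_eq_mul]
        gcongr
        have : P.card ≤ 2 ^ F.card := by
          rw [← Finset.card_powerset]
          exact Finset.card_filter_le _ _
        exact_mod_cast this

open ProbabilityTheory in
/-- Chebyshev's inequality for the vote. -/
lemma measureReal_vote_deviation_le {q : ℝ} (h0 : 0 ≤ q) (h1 : q ≤ 1) (y c : ι → ℤˣ) {δ : ℝ}
    (hδ : 0 < δ) :
    (Measure.pi fun i => noisySign q (y i)).real
      {z | δ ≤ |((∑ i, ((z i * c i : ℤˣ) : ℤ) : ℤ) : ℝ) -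
        (1 - 2 * q) * ((∑ i, ((y i * c i : ℤˣ) : ℤ) : ℤ) : ℝ)|} ≤
      Fintype.card ι / δ ^ 2 := by
  have := fun i => isProbabilityMeasure_noisySign h0 h1 (y i)
  set ν := Measure.pi fun i => noisySign q (y i)
  set f : ∀ i : ι, ℤˣ → ℝ := fun i a => ((a * c i : ℤˣ) : ℤ)
  have hmem : ∀ i, MemLp (f i) 2 (noisySign q (y i)) := fun i => .of_discrete
  set X : (ι → ℤˣ) → ℝ := ∑ i, fun z => f i (z i)
  have hX : MemLp X 2 ν := .of_discrete
  have hXeq : ∀ z, X z = ((∑ i, ((z i * c i : ℤˣ) : ℤ) : ℤ) : ℝ) := by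
    intro z
    simp [X, f]
  have hmean : ∫ z, X z ∂ν = (1 - 2 * q) * ((∑ i, ((y i * c i : ℤˣ) : ℤ) : ℤ) : ℝ) := by
    simp only [X, Finset.sum_apply]
    rw [integral_finsetSum _ fun i _ => .of_finite]
    push_cast
    rw [Finset.mul_sum]
    refine Finset.sum_congr rfl fun i _ => ?_
    rw [integral_comp_eval (μ := fun i => noisySign q (y i)) (i := i) (f := f i)
      Measurable.of_discrete.aestronglyMeasurable, integral_noisySign h0 h1]
    simp only [f]
    push_cast
    ring
  have hvar : Var[X; ν] ≤ Fintype.card ι := by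
    rw [variance_sum_pi hmem]
    calc _ ≤ ∑ i : ι, (1 : ℝ) := by
          refine Finset.sum_le_sum fun i _ => ?_
          refine (variance_le_expectation_sq (hmem i).aestronglyMeasurable).trans ?_
          have : ∀ a, (f i ^ 2) a = 1 := by
            intro a
            simp only [f, Pi.pow_apply]
            rcases Int.units_eq_one_or (a * c i) with h | h <;> rw [h] <;> norm_num
          simp [this]
      _ = _ := by simp
  have hcheb := meas_ge_le_variance_div_sq hX hδ
  rw [hmean] at hcheb
  simp only [hXeq] at hcheb
  rw [Measure.real]
  refine (ENNReal.toReal_mono ENNReal.ofReal_ne_top hcheb).trans ?_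
  rw [ENNReal.toReal_ofReal (div_nonneg (variance_nonneg _ _) (sq_nonneg _))]
  gcongr

end Noise

/-! ### Choosing the global sign by the vote -/

section TwoStage

variable {V : Type*} [Fintype V]

lemma hammingDist_eq_negCount (c y : Labeling V) : hammingDist c y = negCount (c * y) := by
  rw [hammingDist, negCount]
  congr 1
  refine Finset.filter_congr fun v _ => ?_
  simp only [Pi.mul_apply]
  generalize c v = a
  generalize y v = b
  revert a b
  decide

lemma sum_eq_card_sub_two_mul_negCount (s : Labeling V) :
    (((∑ v, ((s v : ℤˣ) : ℤ)) : ℤ) : ℝ) = Fintype.card V - 2 * negCount s := by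
  have h : ∀ v, ((s v : ℤˣ) : ℤ) = 1 - 2 * if s v = -1 then 1 else 0 := by
    intro v
    rcases Int.units_eq_one_or (s v) with h | h <;> simp [h]
  simp only [h, Finset.sum_sub_distrib, ← Finset.mul_sum, negCount]
  simp

open Classical in
/-- The sign chosen by the vote is right unless the vote is far from its mean or the labeling
itself is wrong on a constant fraction of the vertices. -/
lemma hammingDist_vote_le (c y : Labeling V) {a S : ℝ} (ha : 0 < a) :
    ((if S < 0 then hammingDist (-c) y else hammingDist c y : ℕ) : ℝ) ≤
      5 * minority (c * y) + Fintype.card V *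
        if a * Fintype.card V / 2 ≤ |S - a * (Fintype.card V - 2 * negCount (c * y))|
        then 1 else 0 := by
  have hsum : (negCount (c * y) : ℝ) + negCount (-(c * y)) = Fintype.card V := by
    exact_mod_cast negCount_add_negCount_neg (c * y)
  have h1 : (minority (c * y) : ℝ) = min (negCount (c * y) : ℝ) (negCount (-(c * y))) := by
    simp [minority]
  rw [hammingDist_eq_negCount, hammingDist_eq_negCount, neg_mul]
  set N : ℝ := ((Fintype.card V : ℕ) : ℝ)
  set H : ℝ := (negCount (c * y) : ℝ)
  set H' : ℝ := (negCount (-(c * y)) : ℝ)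
  have hH : 0 ≤ H := Nat.cast_nonneg _
  have hH' : 0 ≤ H' := Nat.cast_nonneg _
  have hm : 0 ≤ min H H' := le_min hH hH'
  rw [h1]
  have hle : ((if S < 0 then negCount (-(c * y)) else negCount (c * y) : ℕ) : ℝ) ≤ N := by
    split_ifs
    · change H' ≤ N
      linarith
    · change H ≤ N
      linarith
  by_cases hdev : a * N / 2 ≤ |S - a * (N - 2 * H)|
  · rw [if_pos hdev]
    linarith
  rw [if_neg hdev, mul_zero, add_zero]
  -- If the minority is at least a quarter of `N`, the first term pays even for an error of `N`.
  by_cases hbig : N ≤ 4 * min H H'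
  · linarith
  push Not at hdev hbig
  rw [abs_lt] at hdev
  split_ifs with hS
  · change H' ≤ _
    -- If `4 * H ≤ N`, the mean `a * (N - 2 * H)` is at least `a * N / 2`, and the small deviation
    -- forces `S > 0`. So `H` exceeds a quarter of `N`, the minority is `H'`, and negating is right.
    -- The other case is symmetric.
    have : N < 4 * H := by
      by_contra! hc
      nlinarith
    rcases min_choice H H' with h | h
    · rw [h] at hbig
      linarith
    · rw [h] at hm ⊢
      linarith
  · change H ≤ _
    push Not at hS
    have : N < 4 * H' := by
      by_contra! hc
      nlinarith
    rcases min_choice H H' with h | h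
    · rw [h] at hm ⊢
      linarith
    · rw [h] at hbig
      linarith

/-- The expected error over the vertex observations when the first stage produced `c`. -/
lemma integral_hammingDist_vote_le {q : ℝ} (h0 : 0 ≤ q) (h1 : q < 1 / 2) (y c : Labeling V) :
    ∫ z, (hammingDist (if ∑ v, ((z v * c v : ℤˣ) : ℤ) < 0 then -c else c) y : ℝ)
      ∂(Measure.pi fun v => noisySign q (y v)) ≤
      5 * minority (c * y) + 4 / (1 - 2 * q) ^ 2 := by
  classical
  have := fun v => isProbabilityMeasure_noisySign h0 (by linarith : q ≤ 1) (y v)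
  set ν := Measure.pi fun v => noisySign q (y v)
  set a := 1 - 2 * q with ha_def
  have ha : 0 < a := by linarith
  rcases isEmpty_or_nonempty V with hV | hV
  · have : ∀ c' : Labeling V, hammingDist c' y = 0 := fun c' => by simp [hammingDist]
    simp only [this]
    simp only [Nat.cast_zero, integral_zero]
    positivity
  set N : ℝ := ((Fintype.card V : ℕ) : ℝ)
  have hN : 0 < N := by simp only [N]; exact_mod_cast Fintype.card_pos
  set B : Set (V → ℤˣ) := {z | a * N / 2 ≤ |((∑ v, ((z v * c v : ℤˣ) : ℤ) : ℤ) : ℝ) -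
        a * ((∑ v, ((y v * c v : ℤˣ) : ℤ) : ℤ) : ℝ)|}
  have hB : ν.real B ≤ N / (a * N / 2) ^ 2 :=
    measureReal_vote_deviation_le h0 (by linarith) y c (by positivity)
  have hpt : ∀ z, (hammingDist (if ∑ v, ((z v * c v : ℤˣ) : ℤ) < 0 then -c else c) y : ℝ) ≤
      5 * minority (c * y) + N * B.indicator 1 z := by
    intro z
    have h := hammingDist_vote_le c y (S := ((∑ v, ((z v * c v : ℤˣ) : ℤ) : ℤ) : ℝ)) ha
    have hmean : (((∑ v, ((y v * c v : ℤˣ) : ℤ) : ℤ)) : ℝ) = N - 2 * negCount (c * y) := by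
      rw [← sum_eq_card_sub_two_mul_negCount]
      simp only [Pi.mul_apply, mul_comm]
    rw [← hmean] at h
    convert h using 1
    · rw [apply_ite (fun d => hammingDist d y)]
      congr 1
      simp only [Int.cast_lt_zero]
    · congr 2
  refine (integral_mono .of_finite .of_finite hpt).trans ?_
  rw [integral_add .of_finite .of_finite, integral_const, integral_const_mul,
    integral_indicator_one (Set.toFinite B).measurableSet]
  simp only [probReal_univ, one_smul]
  -- The failure probability `4 / (a ^ 2 * N)` meets an error of at most `N`, so `N` cancels.
  have : N * (N / (a * N / 2) ^ 2) = 4 / a ^ 2 := by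
    field_simp
    norm_num
  rw [← this]
  gcongr

end TwoStage

/-! ### Expected error of both stages together -/

section Main

variable {n : ℕ}

/-- The expected error of the first stage, up to a global sign, in terms of elementary cuts. -/
lemma integral_minority_le {p : ℝ} (h0 : 0 ≤ p) (h1 : p ≤ 1)
    (M : EdgeObs (gridGraph n) → Labeling (Fin n × Fin n)) (hM : IsAgreementMaximizer M)
    (y : Labeling (Fin n × Fin n)) :
    ∫ x, (minority (M x * y) : ℝ)
      ∂(Measure.pi fun e : (gridGraph n).edgeSet => noisySign p (edgeSign y e)) ≤
      ∑ F ∈ elementaryCuts n, (F.card : ℝ) ^ 2 * (2 ^ F.card * p ^ ((F.card + 1) / 2)) := by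
  classical
  have := fun e : (gridGraph n).edgeSet => isProbabilityMeasure_noisySign h0 h1 (edgeSign y e)
  set μ := Measure.pi fun e : (gridGraph n).edgeSet => noisySign p (edgeSign y e)
  set B : Finset (gridGraph n).edgeSet → Set (EdgeObs (gridGraph n)) := fun F =>
    {x | F.card ≤ 2 * (F.filter fun e => x e = -edgeSign y e).card}
  have hpt : ∀ x, (minority (M x * y) : ℝ) ≤
      ∑ F ∈ elementaryCuts n, (F.card : ℝ) ^ 2 * (B F).indicator 1 x := by
    intro x
    calc (minority (M x * y) : ℝ) ≤ ((∑ F ∈ (elementaryCuts n).filter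
            (· ⊆ cut (gridGraph n) (M x * y)), F.card ^ 2 : ℕ) : ℝ) := by
          exact_mod_cast minority_le_sum_elementaryCuts (M x * y)
      _ = ∑ F ∈ elementaryCuts n,
            if F ⊆ cut (gridGraph n) (M x * y) then (F.card : ℝ) ^ 2 else 0 := by
          rw [← Finset.sum_filter]
          push_cast
          rfl
      _ ≤ _ := by
          refine Finset.sum_le_sum fun F hF => ?_
          split_ifs with hsub
          · have hx : x ∈ B F := by
              simp only [elementaryCuts, Finset.mem_filter, Finset.mem_univ, true_and] at hF
              obtain ⟨-, t, rfl⟩ := hF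
              exact card_cut_le_of_agreement_maximal (hM x _) hsub
            simp [Set.indicator, hx]
          · exact mul_nonneg (by positivity) (Set.indicator_nonneg (fun _ _ => zero_le_one) _)
  refine (integral_mono .of_finite .of_finite hpt).trans ?_
  rw [integral_finsetSum _ fun F _ => .of_finite]
  refine Finset.sum_le_sum fun F _ => ?_
  rw [integral_const_mul, integral_indicator_one (Set.toFinite _).measurableSet]
  gcongr
  exact measureReal_half_corrupted_le h0 h1 _ F

/-- Edge and vertex observations are independent: integrate the vote for a fixed first-stage
labeling, then average over the edges. -/
lemma errorAt_twoStage_le {p q : ℝ} (hp0 : 0 ≤ p) (hp1 : p ≤ 1) (hq0 : 0 ≤ q) (hq1 : q < 1 / 2)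
    (M : EdgeObs (gridGraph n) → Labeling (Fin n × Fin n)) (hM : IsAgreementMaximizer M)
    (y : Labeling (Fin n × Fin n)) :
    errorAt p q (twoStage M) y ≤ 5 * (∑ F ∈ elementaryCuts n,
      (F.card : ℝ) ^ 2 * (2 ^ F.card * p ^ ((F.card + 1) / 2))) + 4 / (1 - 2 * q) ^ 2 := by
  have := fun e : (gridGraph n).edgeSet => isProbabilityMeasure_noisySign hp0 hp1 (edgeSign y e)
  have := fun v => isProbabilityMeasure_noisySign hq0 (by linarith : q ≤ 1) (y v)
  rw [errorAt, obsLaw, integral_prod _ .of_finite]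
  refine (integral_mono .of_finite .of_finite
    fun x => integral_hammingDist_vote_le hq0 hq1 y (M x)).trans ?_
  rw [integral_add .of_finite .of_finite, integral_const_mul, integral_const]
  simp only [probReal_univ, one_smul]
  gcongr
  exact integral_minority_le hp0 hp1 M hM y

end Main

end GridRecovery

theorem theorem1 :
    ∃ C : ℝ, ∀ p q : ℝ, 0 < p → p < 1 / 39 → 0 ≤ q → q < 1 / 2 →
      ∃ N₀ : ℕ, ∀ n : ℕ, N₀ ≤ n ^ 2 →
        ∀ M : GridRecovery.EdgeObs (GridRecovery.gridGraph n) →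
            GridRecovery.Labeling (Fin n × Fin n),
          GridRecovery.IsAgreementMaximizer M →
            GridRecovery.worstError p q (GridRecovery.twoStage M) ≤
              C * p ^ 2 * ((n ^ 2 : ℕ) : ℝ) := by
  obtain ⟨K, hK, hsum⟩ := GridRecovery.exists_sum_elementaryCuts_le
  -- `30 = 5 * 6`, with `5` from the vote lemma and `6` from `h3`; the `1` absorbs the Chebyshev
  -- term.
  refine ⟨30 * K + 1, fun p q hp hp' hq hq' => ?_⟩
  have hq2 : 0 < 1 - 2 * q := by linarith
  -- The first summand ensures `n * p ≥ 1`, the second `4 / (1 - 2 * q) ^ 2 ≤ n ^ 2 * p ^ 2`.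
  refine ⟨⌈1 / p ^ 2 + 4 / (1 - 2 * q) ^ 2 / p ^ 2⌉₊, fun n hn M hM => ?_⟩
  have hn' : 1 / p ^ 2 + 4 / (1 - 2 * q) ^ 2 / p ^ 2 ≤ (n : ℝ) ^ 2 := by
    exact_mod_cast Nat.ceil_le.1 hn
  have h1 : 0 < 1 / p ^ 2 := by positivity
  have h2 : 0 < 4 / (1 - 2 * q) ^ 2 / p ^ 2 := by positivity
  have hnp : 1 ≤ n * p := by
    have h : 1 / p ^ 2 ≤ (n : ℝ) ^ 2 := by linarith
    rw [div_le_iff₀ (by positivity), ← mul_pow] at h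
    exact (one_le_sq_iff₀ (by positivity)).1 h
  have hvote : 4 / (1 - 2 * q) ^ 2 ≤ (n : ℝ) ^ 2 * p ^ 2 := by
    rw [← div_le_iff₀ (by positivity)]
    linarith
  have hn1 : (1 : ℝ) ≤ n := by
    rcases Nat.eq_zero_or_pos n with rfl | h
    · norm_num at hnp
    · exact_mod_cast h
  refine ciSup_le fun y => ?_
  refine (GridRecovery.errorAt_twoStage_le hp.le (by linarith) hq hq' M hM y).trans ?_
  -- With `n + 1 ≤ 2 * n`, the terms are at most `4 * (n * p) ^ 2` and `2 * (n * p)`, and `n * p ≤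
  -- (n * p) ^ 2`.
  have h3 : ((n : ℝ) + 1) ^ 2 * p ^ 2 + ((n : ℝ) + 1) * p ≤ 6 * ((n : ℝ) ^ 2 * p ^ 2) := by
    have ha : ((n : ℝ) + 1) * p ≤ 2 * (n * p) := by nlinarith
    have hb : 0 ≤ ((n : ℝ) + 1) * p := by positivity
    have hc : ((n : ℝ) + 1) ^ 2 * p ^ 2 ≤ (2 * (n * p)) ^ 2 := by
      rw [← mul_pow]
      gcongr
    nlinarith
  have h4 := (hsum n p hp hp').trans (mul_le_mul_of_nonneg_left h3 hK)
  push_cast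
  linarith
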